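/- Let $q=p^k$ with $p$ a prime and $k\ge 1$, and let $\mathbb Z_q\subset\mathbb C^\times$ be the group of $q$-th roots of unity. A matrix $H\in M_{2\times N}(\mathbb Z_q)$ is called partial Butson if its two rows are orthogonal, i.e. $\sum_{t=1}^N H_{1t}\overline{H_{2t}}=0$. Let $P_2=P_2(N)$ be the probability that a uniformly random $H\in M_{2\times N}(\mathbb Z_q)$ is partial Butson, that is, the number of partial Butson matrices in $M_{2\times N}(\mathbb Z_q)$ divided by $q^{2N}$. Then, in the limit $N\to\infty$ with $N\in p\mathbb N$, $$P_2\simeq\sqrt{\frac{p^{2-\frac{q}{p}}\,q^{q-\frac{q}{p}}}{(2\pi N)^{q-\frac{q}{p}}}},$$ where $\simeq$ means that the ratio of the two sides tends to $1$. In particular, if $q=p$ is prime, then $P_2\simeq\sqrt{\frac{p^p}{(2\pi N)^{p-1}}}$. Also, if $q=2^k$, then $P_2\simeq 2\sqrt{\left(\frac{q/2}{2\pi N}\right)^{q/2}}$. -/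

import Mathlib

open Filter Asymptotics
open scoped ComplexConjugate

/-- A matrix `H ∈ M_{M × N}(ℤ_q)`, where `ℤ_q ⊂ ℂˣ` is the group of `q`-th roots of unity, is
partial Butson if its rows are pairwise orthogonal in `ℂ^N`. -/
def IsPartialButson {q M N : ℕ} (H : Matrix (Fin M) (Fin N) (rootsOfUnity q ℂ)) : Prop :=
  ∀ i j : Fin M, i ≠ j →
    ∑ t : Fin N, ((H i t : ℂˣ) : ℂ) * conj ((H j t : ℂˣ) : ℂ) = 0

/-- The probability `P_M` for a uniformly random `H ∈ M_{M × N}(ℤ_q)` (with `q ≥ 1`) to be partial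
Butson: the number of partial Butson matrices divided by the number of all matrices. -/
noncomputable def partialButsonProb (q M N : ℕ) : ℝ :=
  (Nat.card {H : Matrix (Fin M) (Fin N) (rootsOfUnity q ℂ) // IsPartialButson H} : ℝ) /
    (Nat.card (Matrix (Fin M) (Fin N) (rootsOfUnity q ℂ)) : ℝ)

/-- The limit `N ∈ pℕ`, `N → ∞`. -/
def atTopMultiples (p : ℕ) : Filter ℕ := atTop ⊓ 𝓟 {N : ℕ | p ∣ N}

/-! Orthogonality of two rows depends only on the word of quotients of their entries, so `P_2` is
the probability that `N` random `q`-th roots of unity sum to zero. Write `q = p * m` with `m` a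
power of `p`. By `sum_mul_pow_eq_zero_iff`, the sum vanishes exactly when the multiplicities are
constant on each of the `m` cosets of the `p`-th roots of unity. For `N = p * n`, summing
multinomial coefficients over these common multiplicities gives `P_2 = (pn)! / q^(pn) * [x^n] (∑ x^b
/ b!^p)^m`.

The coefficient is estimated by Poissonization. Inserting weights `exp (-l) * l^b` turns `1 / b!^p`
into the `p`-th power of a Poisson probability of mean `l`. Poisson probabilities obey a uniform
local limit theorem (`isLocallyGaussian_poissonInt`). This property survives `p`-th powers, which
divide the variance by `p` (`IsLocallyGaussian.pow`), and convolutions, which add centres and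
variances (`IsLocallyGaussian.conv`). With `l = n / m`, the index `n` is the centre of the `m`-fold
convolution, so only the amplitude matters. On a fixed coefficient the weights reduce to an explicit
scalar, and `(pn)!` is handled by Stirling's formula, which is the same local limit theorem read at
the mean. -/

/-! ### Exact count: vanishing sums of roots of unity and multinomials. -/

/-- The words of length `N` over `ι` in which each letter `i` occurs `a i` times are counted by the
multinomial coefficient. -/
theorem card_words_mul_prod_factorial {ι : Type*} [Fintype ι] [DecidableEq ι] (N : ℕ) (a : ι → ℕ)
    (ha : ∑ i, a i = N) :
    (Finset.univ.filter fun w : Fin N → ι =>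
        ∀ i, (Finset.univ.filter fun t => w t = i).card = a i).card * ∏ i, (a i).factorial
      = N.factorial := by
  classical
  set A : ι →₀ ℕ := Finsupp.equivFunOnFinite.symm a with hA
  have hAi : ∀ i, A i = a i := fun i => rfl
  -- Expanding the power gives one monomial per word, whose exponent records the letter counts; the
  -- same coefficient is the multinomial one.
  have key : MvPolynomial.coeff A ((∑ i : ι, (MvPolynomial.X i : MvPolynomial ι ℕ)) ^ N)
      = (Finset.univ.filter fun w : Fin N → ι =>
        ∀ i, (Finset.univ.filter fun t => w t = i).card = a i).card := by
    have h1 : (∑ i : ι, (MvPolynomial.X i : MvPolynomial ι ℕ)) ^ N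
        = ∑ w : Fin N → ι, ∏ t, MvPolynomial.X (w t) := by
      have := Finset.prod_univ_sum (fun _ : Fin N => (Finset.univ : Finset ι))
        (fun _ i => (MvPolynomial.X i : MvPolynomial ι ℕ))
      simpa using this
    rw [h1, MvPolynomial.coeff_sum, Finset.card_filter]
    refine Finset.sum_congr rfl fun w _ => ?_
    have h2 : ∏ t, (MvPolynomial.X (w t) : MvPolynomial ι ℕ)
        = MvPolynomial.monomial (∑ t, Finsupp.single (w t) 1) 1 := by
      rw [MvPolynomial.monomial_sum_one]
      rfl
    rw [h2, MvPolynomial.coeff_monomial]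
    refine if_congr ?_ rfl rfl
    rw [Finsupp.ext_iff]
    refine forall_congr' fun i => ?_
    rw [hAi, Finsupp.finsetSum_apply, Finset.card_filter]
    simp [Finsupp.single_apply]
  have hsum : ∑ i ∈ A.support, A i = N := by
    rw [← ha]
    exact Finset.sum_subset (Finset.subset_univ _) fun i _ hi => by simpa using hi
  have key2 : MvPolynomial.coeff A ((∑ i : ι, (MvPolynomial.X i : MvPolynomial ι ℕ)) ^ N)
      = Nat.multinomial Finset.univ a := by
    rw [MvPolynomial.coeff_sum_X_pow_of_fintype, Finsupp.sum, if_pos hsum, Nat.cast_id]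
    exact Finsupp.multinomial_eq_of_support_subset (Finset.subset_univ _)
  rw [← key, key2, mul_comm, Nat.multinomial_spec, ha]

/-- The only linear relations with natural coefficients between the `p ^ (k + 1)`-th roots of unity
are the sums of cosets of the `p`-th roots of unity. -/
theorem sum_mul_pow_eq_zero_iff {p k m : ℕ} (hp : p.Prime) (hm : m = p ^ k) {ω : ℂ}
    (hω : IsPrimitiveRoot ω (p * m)) (a : Fin p × Fin m → ℕ) :
    ∑ x, (a x : ℂ) * ω ^ (x.2 + m * x.1 : ℕ) = 0 ↔ ∀ j j' r, a (j, r) = a (j', r) := by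
  -- From here on the prime is `p + 1`, and `Fin.last p` is the index to be eliminated.
  obtain ⟨p, rfl⟩ : ∃ p', p = p' + 1 := ⟨p - 1, (Nat.succ_pred_eq_of_pos hp.pos).symm⟩
  have hm0 : 0 < m := hm ▸ pow_pos hp.pos _
  have hgeom : ∑ j : Fin (p + 1), ω ^ (m * j : ℕ) = 0 := by
    have h1 : IsPrimitiveRoot (ω ^ m) (p + 1) :=
      hω.pow (Nat.mul_pos hp.pos hm0) (mul_comm _ _)
    have := h1.geom_sum_eq_zero hp.one_lt
    rw [Finset.sum_range] at this
    simpa [pow_mul] using this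
  constructor
  · intro h
    have hinj : ∀ x y : Fin p × Fin m, (x.2 + m * x.1 : ℕ) = y.2 + m * y.1 → x = y := by
      intro x y hxy
      have h1 := congrArg (· / m) hxy
      have h2 := congrArg (· % m) hxy
      simp only [Nat.add_mul_div_left _ _ hm0, Nat.div_eq_of_lt x.2.2, Nat.div_eq_of_lt y.2.2,
        zero_add] at h1
      simp only [Nat.add_mul_mod_self_left, Nat.mod_eq_of_lt x.2.2, Nat.mod_eq_of_lt y.2.2] at h2
      exact Prod.ext (Fin.ext h1) (Fin.ext h2)
    -- Substituting `ω ^ (m * p) = -∑ j < p, ω ^ (m * j)` into the relation leaves only exponents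
    -- below `p * m`, the degree of the cyclotomic polynomial.
    set P : Polynomial ℤ := ∑ x : Fin p × Fin m,
      Polynomial.monomial (x.2 + m * x.1 : ℕ)
        ((a (x.1.castSucc, x.2) : ℤ) - a (Fin.last p, x.2)) with hP
    have hdeg : P.degree < ((p * m : ℕ) : WithBot ℕ) := by
      refine (Polynomial.degree_sum_le _ _).trans_lt ?_
      rw [Finset.sup_lt_iff (WithBot.bot_lt_coe _)]
      intro x _
      refine (Polynomial.degree_monomial_le _ _).trans_lt ?_
      have h1 : (x.1 : ℕ) + 1 ≤ p := x.1.2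
      have h2 := x.2.2
      have : (x.2 + m * x.1 : ℕ) < p * m := by nlinarith
      exact_mod_cast this
    have hroot : Polynomial.aeval ω P = 0 := by
      rw [← h, hP, map_sum, Fintype.sum_prod_type, Fintype.sum_prod_type, Fin.sum_univ_castSucc]
      have h3 : ω ^ (m * p) = - ∑ j : Fin p, ω ^ (m * j : ℕ) := by
        rw [Fin.sum_univ_castSucc] at hgeom
        simp only [Fin.val_castSucc, Fin.val_last] at hgeom
        linear_combination hgeom
      simp only [Polynomial.aeval_monomial, Fin.val_castSucc, Fin.val_last, pow_add, h3]
      simp only [mul_neg, Finset.sum_neg_distrib, Finset.mul_sum]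
      rw [Finset.sum_comm (s := (Finset.univ : Finset (Fin m))), ← sub_eq_add_neg,
        ← Finset.sum_sub_distrib]
      refine Finset.sum_congr rfl fun j _ => ?_
      rw [← Finset.sum_sub_distrib]
      refine Finset.sum_congr rfl fun r _ => ?_
      simp
      ring
    have hP0 : P = 0 := by
      by_contra hne
      have hpos : 0 < (p + 1) * m := Nat.mul_pos hp.pos hm0
      have h1 := Polynomial.cyclotomic_eq_minpoly hω hpos
      have h2 : minpoly ℤ ω ∣ P := minpoly.isIntegrallyClosed_dvd (hω.isIntegral hpos) hroot
      have h3 := Polynomial.degree_le_of_dvd h2 hne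
      rw [← h1, Polynomial.degree_cyclotomic, hm, ← pow_succ', Nat.totient_prime_pow_succ hp,
        ← hm] at h3
      have h4 := h3.trans_lt hdeg
      have h5 : m * p < p * m := by exact_mod_cast h4
      exact absurd h5 (by rw [mul_comm]; exact lt_irrefl _)
    have hcoef : ∀ (j : Fin p) (r : Fin m), a (j.castSucc, r) = a (Fin.last p, r) := by
      intro j r
      have h1 : P.coeff (r + m * j : ℕ) = 0 := by rw [hP0]; simp
      rw [hP, Polynomial.finsetSum_coeff, Finset.sum_eq_single (j, r)] at h1
      · simp only [Polynomial.coeff_monomial, if_true] at h1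
        exact_mod_cast sub_eq_zero.mp h1
      · intro x _ hx
        rw [Polynomial.coeff_monomial, if_neg]
        exact fun h => hx (hinj x (j, r) h)
      · simp
    have hc : ∀ j r, a (j, r) = a (Fin.last p, r) := fun j r => by
      induction j using Fin.lastCases with
      | last => rfl
      | cast j => exact hcoef j r
    intro j j' r
    rw [hc j, hc j']
  · intro h
    rw [Fintype.sum_prod_type, Finset.sum_comm]
    refine Finset.sum_eq_zero fun r _ => ?_
    have : ∀ j : Fin (p + 1), (a (j, r) : ℂ) * ω ^ (r + m * j : ℕ)
        = (a (Fin.last p, r) : ℂ) * ω ^ (r : ℕ) * ω ^ (m * j : ℕ) := fun j => by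
      rw [h j (Fin.last p) r, pow_add]; ring
    simp_rw [this]
    rw [← Finset.mul_sum, hgeom, mul_zero]

/-- A `2 × N` matrix is determined by its second row and by the word of the quotients of its
columns. -/
theorem natCard_isPartialButson {q : ℕ} [NeZero q] (N : ℕ) :
    Nat.card {H : Matrix (Fin 2) (Fin N) (rootsOfUnity q ℂ) // IsPartialButson H}
      = Nat.card (Fin N → rootsOfUnity q ℂ) *
        Nat.card {w : Fin N → rootsOfUnity q ℂ // ∑ t, ((w t : ℂˣ) : ℂ) = 0} := by
  rw [← Nat.card_prod]
  have hconj : ∀ z : rootsOfUnity q ℂ, conj ((z : ℂˣ) : ℂ) = (((z⁻¹ : rootsOfUnity q ℂ) : ℂˣ) : ℂ) :=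
    fun z => by
      have h1 : ‖((z : ℂˣ) : ℂ)‖ = 1 := Complex.norm_eq_one_of_mem_rootsOfUnity z.2
      rw [← Complex.inv_eq_conj h1]
      simp
  have hB : ∀ H : Matrix (Fin 2) (Fin N) (rootsOfUnity q ℂ), IsPartialButson H ↔
      ∑ t, (((H 0 t * (H 1 t)⁻¹ : rootsOfUnity q ℂ) : ℂˣ) : ℂ) = 0 := by
    intro H
    have h01 : ∑ t, (((H 0 t * (H 1 t)⁻¹ : rootsOfUnity q ℂ) : ℂˣ) : ℂ)
        = ∑ t, ((H 0 t : ℂˣ) : ℂ) * conj ((H 1 t : ℂˣ) : ℂ) :=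
      Finset.sum_congr rfl fun t _ => by rw [hconj]; simp
    rw [h01]
    refine ⟨fun h => h 0 1 (by decide), fun h i j hij => ?_⟩
    fin_cases i <;> fin_cases j
    · exact absurd rfl hij
    · exact h
    · have := congrArg conj h
      rw [map_sum, map_zero] at this
      rw [← this]
      refine Finset.sum_congr rfl fun t _ => ?_
      rw [map_mul, Complex.conj_conj, mul_comm]
      rfl
    · exact absurd rfl hij
  -- For a fixed second row, the first row is recovered by multiplying it by the quotients.
  refine Nat.card_congr
    { toFun := fun H => (H.1 1, ⟨fun t => H.1 0 t * (H.1 1 t)⁻¹, (hB _).1 H.2⟩)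
      invFun := fun x => ⟨Matrix.of ![fun t => x.2.1 t * x.1 t, x.1], (hB _).2 ?_⟩
      left_inv := ?_
      right_inv := ?_ }
  · simpa using x.2.2
  · rintro ⟨H, hH⟩
    ext i t : 3
    fin_cases i <;> simp
  · rintro ⟨v, w, hw⟩
    refine Prod.ext rfl (Subtype.ext (funext fun t => ?_))
    simp

theorem partialButsonProb_two {q : ℕ} [NeZero q] (N : ℕ) :
    partialButsonProb q 2 N
      = (Nat.card {w : Fin N → rootsOfUnity q ℂ // ∑ t, ((w t : ℂˣ) : ℂ) = 0} : ℝ) / q ^ N := by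
  have hc : Nat.card (rootsOfUnity q ℂ) = q := by
    exact Complex.card_rootsOfUnity q
  have h1 : Nat.card (Fin N → rootsOfUnity q ℂ) = q ^ N := by rw [Nat.card_fun, hc, Nat.card_fin]
  have h2 : Nat.card (Matrix (Fin 2) (Fin N) (rootsOfUnity q ℂ)) = q ^ N * q ^ N := by
    have : Nat.card (Fin 2 → Fin N → rootsOfUnity q ℂ) = q ^ N * q ^ N := by
      rw [Nat.card_fun, h1]; simp [sq]
    exact this
  have hq : (q : ℝ) ≠ 0 := Nat.cast_ne_zero.2 (NeZero.ne q)
  rw [partialButsonProb, natCard_isPartialButson, h1, h2]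
  push_cast
  field_simp

/-- The words over `Fin p × Fin m` in which the number of occurrences of `(j, r)` does not depend on
`j` are counted by a power of a power series. -/
theorem card_words_eq_factorial_mul_coeff {p : ℕ} (hp : 0 < p) (m n : ℕ) :
    ((Finset.univ.filter fun w : Fin (p * n) → Fin p × Fin m =>
        ∀ j j' r, (Finset.univ.filter fun t => w t = (j, r)).card
          = (Finset.univ.filter fun t => w t = (j', r)).card).card : ℝ)
      = (p * n).factorial *
        PowerSeries.coeff n ((PowerSeries.mk fun b => ((b.factorial : ℝ)⁻¹) ^ p) ^ m) := by
  classical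
  set S := Finset.univ.filter fun w : Fin (p * n) → Fin p × Fin m =>
        ∀ j j' r, (Finset.univ.filter fun t => w t = (j, r)).card
          = (Finset.univ.filter fun t => w t = (j', r)).card with hS
  -- On `S` the multiplicities along one coset representative determine all of them, so `S` is
  -- fibred over the compositions of `n` into `m` parts.
  let F : (Fin (p * n) → Fin p × Fin m) → (Fin m →₀ ℕ) := fun w =>
    Finsupp.equivFunOnFinite.symm fun r => (Finset.univ.filter fun t => w t = (⟨0, hp⟩, r)).card
  have hF : ∀ w r, F w r = (Finset.univ.filter fun t => w t = (⟨0, hp⟩, r)).card := fun _ _ => rfl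
  have hmem : ∀ w ∈ S, F w ∈ Finset.finsuppAntidiag Finset.univ n := by
    intro w hw
    rw [hS, Finset.mem_filter] at hw
    rw [Finset.mem_finsuppAntidiag]
    refine ⟨?_, Finset.subset_univ _⟩
    have h1 : ∑ x : Fin p × Fin m, (Finset.univ.filter fun t => w t = x).card = p * n := by
      rw [← Finset.card_eq_sum_card_fiberwise (fun _ _ => Finset.mem_coe.2 (Finset.mem_univ _))]
      simp
    rw [Fintype.sum_prod_type] at h1
    have h2 : ∀ j : Fin p, ∑ r, (Finset.univ.filter fun t => w t = (j, r)).card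
        = ∑ r, F w r := fun j => Finset.sum_congr rfl fun r _ => hw.2 j ⟨0, hp⟩ r
    simp_rw [h2] at h1
    simpa [hp.ne'] using h1
  rw [Finset.card_eq_sum_card_fiberwise hmem, ← Fin.prod_const, PowerSeries.coeff_prod,
    Finset.mul_sum]
  push_cast
  refine Finset.sum_congr rfl fun b hb => ?_
  rw [Finset.mem_finsuppAntidiag] at hb
  have hcount := card_words_mul_prod_factorial (ι := Fin p × Fin m) (p * n) (fun x => b x.2)
    (by rw [Fintype.sum_prod_type]; simp [hb.1])
  have hset : S.filter (fun w => F w = b) = Finset.univ.filter fun w : Fin (p * n) → Fin p × Fin m =>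
      ∀ x, (Finset.univ.filter fun t => w t = x).card = b x.2 := by
    ext w
    simp only [hS, Finset.mem_filter, Finset.mem_univ, true_and, Prod.forall]
    constructor
    · rintro ⟨h1, rfl⟩ j r
      exact h1 j ⟨0, hp⟩ r
    · intro h
      exact ⟨fun j j' r => by rw [h, h], Finsupp.ext fun r => h _ r⟩
  rw [hset, ← hcount, Fintype.prod_prod_type]
  push_cast
  simp only [PowerSeries.coeff_mk, Finset.prod_const, Finset.card_univ, Fintype.card_fin, inv_pow,
    Finset.prod_inv_distrib, Finset.prod_pow]
  rw [mul_assoc, mul_inv_cancel₀, mul_one]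
  exact pow_ne_zero _ (Finset.prod_ne_zero_iff.2 fun i _ => by positivity)

theorem partialButsonProb_two_prime_pow {p k m : ℕ} (hp : p.Prime) (hm : m = p ^ k) (n : ℕ) :
    partialButsonProb (p * m) 2 (p * n)
      = (p * n).factorial / ((p : ℝ) * m) ^ (p * n) *
        PowerSeries.coeff n ((PowerSeries.mk fun b => ((b.factorial : ℝ)⁻¹) ^ p) ^ m) := by
  classical
  have hm0 : 0 < m := hm ▸ pow_pos hp.pos _
  have hq : 0 < p * m := Nat.mul_pos hp.pos hm0
  have : NeZero (p * m) := ⟨hq.ne'⟩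
  have hω := Complex.isPrimitiveRoot_exp (p * m) hq.ne'
  set ω := Complex.exp (2 * Real.pi * Complex.I / ((p * m : ℕ) : ℂ))
  have hmul : ∀ x : Fin p × Fin m, (x.2 + m * x.1 : ℕ) < p * m := fun x => by
    have h1 : (x.1 : ℕ) + 1 ≤ p := x.1.2
    have h2 := x.2.2
    nlinarith
  let z : rootsOfUnity (p * m) ℂ := hω.toRootsOfUnity
  have hz : ∀ i : ℕ, (((z ^ i : rootsOfUnity (p * m) ℂ) : ℂˣ) : ℂ) = ω ^ i := fun i => by
    simp [z]
  -- Since `z ^ m` has order `p`, `x.2` selects the coset of the `p`-th roots of unity and `x.1` the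
  -- position within it.
  let e : Fin p × Fin m → rootsOfUnity (p * m) ℂ := fun x => z ^ (x.2 + m * x.1 : ℕ)
  have he : Function.Bijective e := by
    have : Fintype (rootsOfUnity (p * m) ℂ) := Fintype.ofFinite _
    rw [Fintype.bijective_iff_injective_and_card]
    constructor
    · intro x y hxy
      have h0 : ω ^ (x.2 + m * x.1 : ℕ) = ω ^ (y.2 + m * y.1 : ℕ) := by
        rw [← hz, ← hz]; exact congrArg (fun u : rootsOfUnity (p * m) ℂ => ((u : ℂˣ) : ℂ)) hxy
      have hxy := hω.pow_inj (hmul x) (hmul y) h0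
      have h1 := congrArg (· / m) hxy
      have h2 := congrArg (· % m) hxy
      simp only [Nat.add_mul_div_left _ _ hm0, Nat.div_eq_of_lt x.2.2, Nat.div_eq_of_lt y.2.2,
        zero_add] at h1
      simp only [Nat.add_mul_mod_self_left, Nat.mod_eq_of_lt x.2.2, Nat.mod_eq_of_lt y.2.2] at h2
      exact Prod.ext (Fin.ext h1) (Fin.ext h2)
    · have := Complex.card_rootsOfUnity (p * m)
      rw [Fintype.card_eq_nat_card, Fintype.card_eq_nat_card, this]
      simp
  have hcard : Nat.card {w : Fin (p * n) → rootsOfUnity (p * m) ℂ // ∑ t, ((w t : ℂˣ) : ℂ) = 0}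
      = (Finset.univ.filter fun w : Fin (p * n) → Fin p × Fin m =>
        ∀ j j' r, (Finset.univ.filter fun t => w t = (j, r)).card
          = (Finset.univ.filter fun t => w t = (j', r)).card).card := by
    rw [← Fintype.card_subtype, ← Nat.card_eq_fintype_card]
    refine (Nat.card_congr ?_).symm
    refine (Equiv.arrowCongr (Equiv.refl _) (Equiv.ofBijective e he)).subtypeEquiv fun w => ?_
    rw [← sum_mul_pow_eq_zero_iff hp hm hω fun x => (Finset.univ.filter fun t => w t = x).card]
    have : ∑ t, ω ^ ((w t).2 + m * (w t).1 : ℕ)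
        = ∑ x : Fin p × Fin m, ((Finset.univ.filter fun t => w t = x).card : ℂ)
          * ω ^ (x.2 + m * x.1 : ℕ) := by
      rw [← Finset.sum_fiberwise' Finset.univ w (fun x => ω ^ (x.2 + m * x.1 : ℕ))]
      simp
    rw [← this]
    refine Eq.congr (Finset.sum_congr rfl fun t _ => ?_) rfl
    exact (hz _).symm
  rw [partialButsonProb_two, hcard, card_words_eq_factorial_mul_coeff hp.pos]
  push_cast
  ring

/-! ### Gaussian profiles and their Riemann sums. -/

/-- The Gaussian of amplitude `A` and variance `v * l`, centred at the origin. -/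
noncomputable def gaussianProfile (A v l x : ℝ) : ℝ := A * Real.exp (-x ^ 2 / (2 * v * l))

/-- Identifies the lattice sum with a theta function, so that its functional equation can serve as
Poisson summation. -/
theorem hasSum_gaussianProfile_evenKernel {v l : ℝ} (hv : 0 < v) (hl : 0 < l) (A s : ℝ) :
    HasSum (fun j : ℤ => gaussianProfile A v l (s - j))
      (A * HurwitzZeta.evenKernel ((-s : ℝ) : UnitAddCircle) (1 / (2 * Real.pi * v * l))) := by
  have h := HurwitzZeta.hasSum_int_evenKernel (-s) (t := 1 / (2 * Real.pi * v * l)) (by positivity)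
  refine (h.mul_left A).congr_fun fun j => ?_
  simp only [gaussianProfile]
  congr 2
  have := Real.pi_ne_zero
  field_simp
  ring

theorem summable_gaussianProfile {v l : ℝ} (hv : 0 < v) (hl : 0 < l) (A s : ℝ) :
    Summable fun j : ℤ => gaussianProfile A v l (s - j) :=
  (hasSum_gaussianProfile_evenKernel hv hl A s).summable

/-- The translation `s` enters the Fourier side only through unimodular factors, so `s = 0` is the
worst case. This makes the Riemann sum estimate uniform in `s`. -/
theorem abs_cosKernel_sub_one_le (s : ℝ) {t : ℝ} (ht : 0 < t) :
    |HurwitzZeta.cosKernel (s : UnitAddCircle) t - 1| ≤ HurwitzZeta.cosKernel 0 t - 1 := by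
  have h1 := HurwitzZeta.hasSum_int_cosKernel₀ s ht
  have h0 := HurwitzZeta.hasSum_int_cosKernel₀ 0 ht
  have h0' : HasSum (fun n : ℤ => if n = 0 then 0 else Real.exp (-Real.pi * n ^ 2 * t))
      (HurwitzZeta.cosKernel 0 t - 1) := by
    rw [← Complex.hasSum_ofReal]
    convert h0 using 1
    · ext n; split_ifs <;> simp
    · simp
  have h2 : ‖((HurwitzZeta.cosKernel (s : UnitAddCircle) t : ℂ) - 1)‖
      ≤ HurwitzZeta.cosKernel 0 t - 1 := by
    rw [← h1.tsum_eq]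
    refine tsum_of_norm_bounded h0' fun n => ?_
    split_ifs with hn
    · simp
    · rw [norm_mul]
      have : (2 * Real.pi * Complex.I * s * n : ℂ) = ((2 * Real.pi * s * n : ℝ) : ℂ) * Complex.I := by
        push_cast; ring
      rw [this, Complex.norm_exp_ofReal_mul_I, one_mul, Complex.norm_real, Real.norm_eq_abs,
        Real.abs_exp]
  rw [← Complex.ofReal_one, ← Complex.ofReal_sub, Complex.norm_real, Real.norm_eq_abs] at h2
  exact h2

/-- Riemann sums of a Gaussian converge to its integral, uniformly in the translation. -/
theorem eventually_abs_tsum_gaussianProfile_sub_le {v : ℝ} (hv : 0 < v) (A : ℝ) {ε : ℝ}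
    (hε : 0 < ε) :
    ∀ᶠ l in atTop, ∀ s : ℝ,
      |(√l)⁻¹ * ∑' j : ℤ, gaussianProfile A v l (s - j) - A * √(2 * Real.pi * v)| ≤ ε := by
  have hlim : Tendsto (fun l : ℝ => |A| * √(2 * Real.pi * v) *
      (HurwitzZeta.cosKernel 0 (2 * Real.pi * v * l) - 1)) atTop (nhds 0) := by
    obtain ⟨p, hp, hO⟩ := HurwitzZeta.isBigO_atTop_cosKernel_sub 0
    have h1 : Tendsto (fun x : ℝ => Real.exp (-p * x)) atTop (nhds 0) :=
      Real.tendsto_exp_atBot.comp (tendsto_id.const_mul_atTop_of_neg (by linarith))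
    have h2 := hO.trans_tendsto h1
    have h3 : Tendsto (fun l : ℝ => 2 * Real.pi * v * l) atTop atTop :=
      tendsto_id.const_mul_atTop (by positivity)
    simpa using (h2.comp h3).const_mul (|A| * √(2 * Real.pi * v))
  filter_upwards [hlim.eventually (ge_mem_nhds hε), eventually_gt_atTop 0] with l hl hl0 s
  refine le_trans ?_ hl
  -- The functional equation exchanges the small parameter `1 / (2πvl)` for the large one `2πvl`,
  -- where the dual kernel is exponentially close to 1.
  rw [(hasSum_gaussianProfile_evenKernel hv hl0 A s).tsum_eq,
    HurwitzZeta.evenKernel_functional_equation, one_div_one_div, ← Real.sqrt_eq_rpow,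
    one_div (2 * Real.pi * v * l), Real.sqrt_inv, one_div, inv_inv,
    Real.sqrt_mul (by positivity : 0 ≤ 2 * Real.pi * v)]
  have hs : √l ≠ 0 := (Real.sqrt_pos.2 hl0).ne'
  have : (√l)⁻¹ * (A * (√(2 * Real.pi * v) * √l *
      HurwitzZeta.cosKernel ((-s : ℝ) : UnitAddCircle) (2 * Real.pi * v * l)))
      - A * √(2 * Real.pi * v)
      = A * √(2 * Real.pi * v) *
        (HurwitzZeta.cosKernel ((-s : ℝ) : UnitAddCircle) (2 * Real.pi * v * l) - 1) := by
    field_simp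
  rw [this, abs_mul, abs_mul, abs_of_nonneg (Real.sqrt_nonneg (2 * Real.pi * v))]
  exact mul_le_mul_of_nonneg_left (abs_cosKernel_sub_one_le _ (by positivity)) (by positivity)

/-! ### Stability of local limit theorems under powers and convolutions. -/

/-- A family of nonnegative sequences of bounded mass that satisfies a local limit theorem: rescaled
by `√l`, the sequence `u l` is uniformly close to a Gaussian centred at `c * l` of variance
`v * l`. -/
structure IsLocallyGaussian (u : ℝ → ℤ → ℝ) (A v c : ℝ) : Prop where
  bounded : ∃ C, ∀ᶠ l in atTop, (∀ b, 0 ≤ u l b) ∧ Summable (u l) ∧ ∑' b, u l b ≤ C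
  approx : ∀ ε > 0, ∀ᶠ l in atTop, ∀ b : ℤ, |√l * u l b - gaussianProfile A v l (b - c * l)| ≤ ε

theorem abs_gaussianProfile_le {A v l : ℝ} (hv : 0 < v) (hl : 0 < l) (x : ℝ) :
    |gaussianProfile A v l x| ≤ |A| := by
  rw [gaussianProfile, abs_mul, Real.abs_exp]
  refine mul_le_of_le_one_right (abs_nonneg _) (Real.exp_le_one_iff.2 ?_)
  rw [neg_div, neg_nonpos]
  positivity

theorem IsLocallyGaussian.eventually_abs_le {u : ℝ → ℤ → ℝ} {A v c : ℝ}
    (h : IsLocallyGaussian u A v c) (hv : 0 < v) :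
    ∀ᶠ l in atTop, ∀ b, |√l * u l b| ≤ |A| + 1 := by
  filter_upwards [h.approx 1 one_pos, eventually_gt_atTop 0] with l hl hl0 b
  have h1 := abs_sub_abs_le_abs_sub (√l * u l b) (gaussianProfile A v l (b - c * l))
  linarith [hl b, abs_gaussianProfile_le (A := A) hv hl0 (b - c * l)]

theorem gaussianProfile_pow (A v l x : ℝ) {p : ℕ} (hp : p ≠ 0) :
    gaussianProfile A v l x ^ p = gaussianProfile (A ^ p) (v / p) l x := by
  rw [gaussianProfile, gaussianProfile, mul_pow, ← Real.exp_nat_mul]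
  congr 2
  have : (p : ℝ) ≠ 0 := Nat.cast_ne_zero.2 hp
  field_simp

/-- Rescaled values are uniformly bounded by `M`, so taking `p`-th powers is Lipschitz on them and
multiplies the mass by at most `M ^ (p - 1)`. -/
theorem IsLocallyGaussian.pow {u : ℝ → ℤ → ℝ} {A v c : ℝ} (h : IsLocallyGaussian u A v c)
    (hv : 0 < v) {p : ℕ} (hp : p ≠ 0) :
    IsLocallyGaussian (fun l b => (√l * u l b) ^ p / √l) (A ^ p) (v / p) c := by
  obtain ⟨C, hC⟩ := h.bounded
  set M := |A| + 1 with hM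
  have hM0 : 0 < M := by positivity
  refine ⟨⟨M ^ (p - 1) * C, ?_⟩, fun ε hε => ?_⟩
  · filter_upwards [hC, h.eventually_abs_le hv, eventually_gt_atTop 0] with l ⟨h0, hs, hC⟩ hb hl0
    have hsq : 0 < √l := Real.sqrt_pos.2 hl0
    have hle : ∀ b, (√l * u l b) ^ p / √l ≤ M ^ (p - 1) * u l b := fun b => by
      rw [div_le_iff₀ hsq, ← Nat.sub_add_cancel (Nat.one_le_iff_ne_zero.2 hp), pow_succ,
        Nat.add_sub_cancel]
      have : (√l * u l b) ^ (p - 1) ≤ M ^ (p - 1) :=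
        pow_le_pow_left₀ (mul_nonneg hsq.le (h0 b)) (le_of_abs_le (hb b)) _
      nlinarith [mul_nonneg hsq.le (h0 b)]
    have hnn : ∀ b, 0 ≤ (√l * u l b) ^ p / √l := fun b =>
      div_nonneg (pow_nonneg (mul_nonneg hsq.le (h0 b)) _) hsq.le
    have hs' := Summable.of_nonneg_of_le hnn hle (hs.mul_left _)
    refine ⟨hnn, hs', (hs'.tsum_le_tsum hle (hs.mul_left _)).trans ?_⟩
    rw [tsum_mul_left]
    exact mul_le_mul_of_nonneg_left hC (by positivity)
  · have hK : 0 < (p : ℝ) * M ^ (p - 1) := by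
      have : 0 < p := Nat.pos_of_ne_zero hp
      positivity
    filter_upwards [h.approx (ε / (p * M ^ (p - 1))) (by positivity), h.eventually_abs_le hv,
      eventually_gt_atTop 0] with l happ hb hl0 b
    have hsq : √l ≠ 0 := (Real.sqrt_pos.2 hl0).ne'
    rw [← gaussianProfile_pow _ _ _ _ hp, mul_div_cancel₀ _ hsq]
    have h1 := abs_pow_sub_pow_le (√l * u l b) (gaussianProfile A v l (b - c * l)) p
    refine h1.trans ?_
    have hmax : max |√l * u l b| |gaussianProfile A v l (b - c * l)| ≤ M :=
      max_le (hb b) ((abs_gaussianProfile_le hv hl0 _).trans (by simp [hM]))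
    calc _ ≤ ε / (p * M ^ (p - 1)) * p * M ^ (p - 1) := by
          gcongr
          exact happ b
      _ = ε := by field_simp

/-- The convolution of two sequences indexed by `ℤ`. -/
noncomputable def intConv (f g : ℤ → ℝ) (n : ℤ) : ℝ := ∑' j : ℤ, f j * g (n - j)

/-- The shear `(n, j) ↦ (j, n - j)` of `ℤ × ℤ`. -/
def intShear : ℤ × ℤ ≃ ℤ × ℤ where
  toFun x := (x.2, x.1 - x.2)
  invFun x := (x.1 + x.2, x.1)
  left_inv x := by simp
  right_inv x := by simp

theorem hasSum_intConv {f g : ℤ → ℝ} (hf : ∀ b, 0 ≤ f b) (hg : ∀ b, 0 ≤ g b) (hfs : Summable f)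
    (hgs : Summable g) : HasSum (intConv f g) ((∑' b, f b) * ∑' b, g b) := by
  have h1 : Summable fun x : ℤ × ℤ => f x.1 * g x.2 := hfs.mul_of_nonneg hgs hf hg
  have h2 : HasSum (fun x : ℤ × ℤ => f x.1 * g x.2) ((∑' b, f b) * ∑' b, g b) := by
    rw [hfs.tsum_mul_tsum hgs h1]
    exact h1.hasSum
  have h3 := (intShear.hasSum_iff).2 h2
  exact h3.prod_fiberwise fun n => (h3.summable.prod_factor n).hasSum

/-- Completing the square in `y`: the factor free of `y` already has the variance `v + v'` of the
convolution. -/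
theorem gaussianProfile_mul (A A' : ℝ) {v v' l : ℝ} (hv : 0 < v) (hv' : 0 < v') (hl : 0 < l)
    (y z : ℝ) :
    gaussianProfile A v l y * gaussianProfile A' v' l (z - y)
      = Real.exp (-z ^ 2 / (2 * (v + v') * l)) *
        gaussianProfile (A * A') (v * v' / (v + v')) l (z * v / (v + v') - y) := by
  have h : ∀ a b : ℝ, A * Real.exp a * (A' * Real.exp b) = A * A' * Real.exp (a + b) := fun a b => by
    rw [Real.exp_add]; ring
  have h' : ∀ a b : ℝ, Real.exp a * (A * A' * Real.exp b) = A * A' * Real.exp (a + b) :=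
    fun a b => by rw [Real.exp_add]; ring
  rw [gaussianProfile, gaussianProfile, gaussianProfile, h, h']
  congr 2
  have : v + v' ≠ 0 := by positivity
  field_simp
  ring

/-- The two factors are replaced by Gaussians one at a time. The first replacement costs the uniform
error of `w` times the mass of `u`, the second the uniform error of `u` times a Gaussian Riemann
sum; what remains is a Riemann sum of a product of Gaussians. -/
theorem IsLocallyGaussian.conv {u w : ℝ → ℤ → ℝ} {A A' v v' c c' : ℝ}
    (hu : IsLocallyGaussian u A v c) (hw : IsLocallyGaussian w A' v' c') (hv : 0 < v)
    (hv' : 0 < v') :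
    IsLocallyGaussian (fun l => intConv (u l) (w l))
      (A * A' * √(2 * Real.pi * (v * v' / (v + v')))) (v + v') (c + c') := by
  obtain ⟨C, hC⟩ := hu.bounded
  obtain ⟨C', hC'⟩ := hw.bounded
  refine ⟨⟨|C| * |C'|, ?_⟩, fun ε hε => ?_⟩
  · filter_upwards [hC, hC'] with l ⟨h0, hs, hC⟩ ⟨h0', hs', hC'⟩
    have h := hasSum_intConv h0 h0' hs hs'
    refine ⟨fun n => tsum_nonneg fun j => mul_nonneg (h0 _) (h0' _), h.summable, ?_⟩
    rw [h.tsum_eq]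
    exact mul_le_mul (hC.trans (le_abs_self _)) (hC'.trans (le_abs_self _))
      (tsum_nonneg h0') (abs_nonneg _)
  -- `K` bounds the Riemann sum of `|g'|`: its limit plus the error 1 allowed in `hlat'`.
  set K := |A'| * √(2 * Real.pi * v') + 1 with hK
  have hK0 : 0 < K := by positivity
  have hvv : 0 < v * v' / (v + v') := by positivity
  filter_upwards [hC, hC', hw.approx (ε / (3 * (|C| + 1))) (by positivity),
    hu.approx (ε / (3 * K)) (by positivity),
    eventually_abs_tsum_gaussianProfile_sub_le hvv (A * A') (ε := ε / 3) (by positivity),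
    eventually_abs_tsum_gaussianProfile_sub_le hv' |A'| one_pos,
    eventually_gt_atTop 0] with l ⟨h0, hs, hC⟩ ⟨h0', hs', hC'⟩ haw hau hlat hlat' hl0 n
  have hsq : 0 < √l := Real.sqrt_pos.2 hl0
  set g : ℤ → ℝ := fun j => gaussianProfile A v l (j - c * l) with hg
  set g' : ℤ → ℝ := fun j => gaussianProfile A' v' l (n - j - c' * l) with hg'
  have hg's : Summable g' := by
    refine (summable_gaussianProfile hv' hl0 A' (n - c' * l)).congr fun j => ?_
    simp only [hg']; congr 1; ring
  have habs : ∀ j, |g' j| = gaussianProfile |A'| v' l ((n - c' * l) - j) := fun j => by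
    simp only [hg', gaussianProfile, abs_mul, Real.abs_exp]
    congr 4; ring
  have hg'K : (√l)⁻¹ * ∑' j, |g' j| ≤ K := by
    have := le_of_abs_le (hlat' (n - c' * l))
    simp_rw [habs]
    linarith
  have hg'abs : Summable fun j => |g' j| := hg's.abs
  have haw' : ∀ j : ℤ, |√l * w l (n - j) - g' j| ≤ ε / (3 * (|C| + 1)) := fun j => by
    have := haw (n - j)
    push_cast at this
    exact this
  have hgg : ∀ j, g j * g' j = Real.exp (-(n - (c + c') * l) ^ 2 / (2 * (v + v') * l)) *
      gaussianProfile (A * A') (v * v' / (v + v')) l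
        (((n - (c + c') * l) * v / (v + v') + c * l) - j) := fun j => by
    simp only [hg, hg']
    have h := gaussianProfile_mul A A' hv hv' hl0 (j - c * l) (n - (c + c') * l)
    have e1 : (n : ℝ) - (c + c') * l - (j - c * l) = n - j - c' * l := by ring
    have e2 : ((n : ℝ) - (c + c') * l) * v / (v + v') - (j - c * l)
        = ((n - (c + c') * l) * v / (v + v') + c * l) - j := by ring
    rw [e1, e2] at h
    exact h
  have hggs : Summable fun j => g j * g' j := by
    simp_rw [hgg]
    exact (summable_gaussianProfile hvv hl0 _ _).mul_left _
  have hug : Summable fun j => u l j * g' j := by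
    refine (hs.mul_right |A'|).of_norm_bounded fun j => ?_
    rw [Real.norm_eq_abs, abs_mul, abs_of_nonneg (h0 j)]
    exact mul_le_mul_of_nonneg_left (abs_gaussianProfile_le hv' hl0 _) (h0 j)
  have huw : Summable fun j => u l j * w l (n - j) := by
    have hd : Summable fun j => u l j * (√l * w l (n - j) - g' j) := by
      refine (hs.mul_right (ε / (3 * (|C| + 1)))).of_norm_bounded fun j => ?_
      rw [Real.norm_eq_abs, abs_mul, abs_of_nonneg (h0 j)]
      exact mul_le_mul_of_nonneg_left (haw' j) (h0 j)
    refine ((hd.add hug).mul_left (√l)⁻¹).congr fun j => ?_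
    field_simp
    ring
  have hT1 : |√l * intConv (u l) (w l) n - ∑' j, u l j * g' j| ≤ ε / 3 := by
    have heq : √l * intConv (u l) (w l) n - ∑' j, u l j * g' j
        = ∑' j, u l j * (√l * w l (n - j) - g' j) := by
      rw [intConv, ← tsum_mul_left, ← (huw.mul_left _).tsum_sub hug]
      exact tsum_congr fun j => by ring
    rw [heq, ← Real.norm_eq_abs]
    have hb := tsum_of_norm_bounded (f := fun j => u l j * (√l * w l (n - j) - g' j))
      (hs.mul_right (ε / (3 * (|C| + 1)))).hasSum
      fun j => by
        rw [Real.norm_eq_abs, abs_mul, abs_of_nonneg (h0 j)]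
        exact mul_le_mul_of_nonneg_left (haw' j) (h0 j)
    refine hb.trans ?_
    rw [tsum_mul_right]
    have : ∑' b, u l b ≤ |C| + 1 := hC.trans ((le_abs_self _).trans (by linarith))
    calc _ ≤ (|C| + 1) * (ε / (3 * (|C| + 1))) := by gcongr
      _ = ε / 3 := by field_simp
  have hT2 : |∑' j, u l j * g' j - (√l)⁻¹ * ∑' j, g j * g' j| ≤ ε / 3 := by
    have heq : ∑' j, u l j * g' j - (√l)⁻¹ * ∑' j, g j * g' j
        = ∑' j, (√l)⁻¹ * ((√l * u l j - g j) * g' j) := by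
      rw [← tsum_mul_left, ← hug.tsum_sub (hggs.mul_left _)]
      exact tsum_congr fun j => by field_simp
    rw [heq, ← Real.norm_eq_abs]
    have hb := tsum_of_norm_bounded (f := fun j => (√l)⁻¹ * ((√l * u l j - g j) * g' j))
      ((hg'abs.mul_left (ε / (3 * K))).mul_left (√l)⁻¹).hasSum
      fun j => by
        rw [Real.norm_eq_abs, abs_mul, abs_mul, abs_of_pos (inv_pos.2 hsq)]
        gcongr
        exact hau j
    refine hb.trans ?_
    rw [tsum_mul_left, tsum_mul_left]
    calc _ = ε / (3 * K) * ((√l)⁻¹ * ∑' j, |g' j|) := by ring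
      _ ≤ ε / (3 * K) * K := by gcongr
      _ = ε / 3 := by field_simp
  -- The shift of the inner Gaussian depends on `n`, hence the need for an estimate uniform in the
  -- translation.
  have hT3 : |(√l)⁻¹ * ∑' j, g j * g' j
      - gaussianProfile (A * A' * √(2 * Real.pi * (v * v' / (v + v')))) (v + v') l
        (n - (c + c') * l)| ≤ ε / 3 := by
    set E := Real.exp (-(n - (c + c') * l) ^ 2 / (2 * (v + v') * l)) with hE
    have hE1 : E ≤ 1 := by
      refine Real.exp_le_one_iff.2 ?_
      rw [neg_div, neg_nonpos]
      positivity
    simp_rw [hgg]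
    rw [tsum_mul_left, gaussianProfile, ← hE]
    have := hlat ((n - (c + c') * l) * v / (v + v') + c * l)
    rw [mul_left_comm, mul_comm (A * A' * _) E, ← mul_sub, abs_mul, abs_of_pos (Real.exp_pos _)]
    calc _ ≤ 1 * (ε / 3) := by gcongr
      _ = ε / 3 := one_mul _
  calc _ ≤ _ + _ + _ := (abs_sub_le _ (∑' j, u l j * g' j) _).trans
        (add_le_add_right (abs_sub_le _ ((√l)⁻¹ * ∑' j, g j * g' j) _) _ |>.trans_eq (add_assoc _ _ _).symm)
    _ ≤ ε / 3 + ε / 3 + ε / 3 := by gcongr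
    _ = ε := by ring

/-! ### The local limit theorem for the Poisson distribution. -/

/-- The Poisson distribution of mean `l`, extended by zero to `ℤ`. -/
noncomputable def poissonInt (l : ℝ) (b : ℤ) : ℝ :=
  if 0 ≤ b then Real.exp (-l) * l ^ b.toNat / b.toNat.factorial else 0

theorem hasSum_poissonInt (l : ℝ) : HasSum (poissonInt l) 1 := by
  have h1 : HasSum (fun n : ℕ => poissonInt l n) 1 := by
    have h := (NormedSpace.expSeries_div_hasSum_exp (𝔸 := ℝ) l).mul_left (Real.exp (-l))
    rw [← Real.exp_eq_exp_ℝ, ← Real.exp_add, neg_add_cancel, Real.exp_zero] at h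
    refine h.congr_fun fun n => ?_
    simp [poissonInt, mul_div_assoc]
  have h2 := Function.Injective.hasSum_iff (f := poissonInt l) (a := 1) Nat.cast_injective
    (fun b hb => by
      rw [poissonInt, if_neg]
      intro h0
      exact hb ⟨b.toNat, by simp [h0]⟩)
  exact h2.1 h1

theorem poissonInt_nonneg {l : ℝ} (hl : 0 ≤ l) (b : ℤ) : 0 ≤ poissonInt l b := by
  rw [poissonInt]; split_ifs <;> positivity

theorem integral_exp_int_mul_I (n : ℤ) :
    ∫ θ in (-Real.pi)..Real.pi, Complex.exp (n * θ * Complex.I) = if n = 0 then 2 * Real.pi else 0 := by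
  split_ifs with hn
  · subst hn; simp; ring
  · have hc : (n * Complex.I : ℂ) ≠ 0 := by simp [hn]
    have h1 := integral_exp_mul_complex (a := -Real.pi) (b := Real.pi) hc
    have h2 : ∀ θ : ℝ, (n * θ * Complex.I : ℂ) = n * Complex.I * θ := fun θ => by ring
    simp_rw [h2]
    rw [h1]
    have h3 : Complex.exp (n * Complex.I * Real.pi) = Complex.exp (n * Complex.I * ((-Real.pi : ℝ) : ℂ)) := by
      rw [Complex.exp_eq_exp_iff_exists_int]
      exact ⟨n, by push_cast; ring⟩
    rw [h3, sub_self, zero_div, Complex.ofReal_zero]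

/-- The Poisson probabilities are the Fourier coefficients of the characteristic function. -/
theorem integral_poisson_charFun (l : ℝ) (b : ℤ) :
    ∫ θ in (-Real.pi)..Real.pi,
      Complex.exp (l * (Complex.exp (θ * Complex.I) - 1) - b * θ * Complex.I)
      = 2 * Real.pi * poissonInt l b := by
  -- Expand `exp (l * e^(iθ))` as a series and integrate termwise; orthogonality of the exponentials
  -- keeps only the term `n = b`.
  set F : ℕ → ℝ → ℂ := fun n θ =>
    (Real.exp (-l) * l ^ n / n.factorial : ℝ) * Complex.exp (((n : ℤ) - b : ℤ) * θ * Complex.I) with hF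
  have hS : Summable fun n : ℕ => |Real.exp (-l) * l ^ n / n.factorial| := by
    have h := ((NormedSpace.expSeries_div_hasSum_exp (𝔸 := ℝ) l).mul_left (Real.exp (-l))).summable.abs
    exact h.congr fun n => by rw [mul_div_assoc]
  have hFnorm : ∀ n θ, ‖F n θ‖ = |Real.exp (-l) * l ^ n / n.factorial| := fun n θ => by
    have : (((((n : ℤ) - b : ℤ) : ℂ)) * θ * Complex.I) = (((((n : ℤ) - b : ℤ) : ℝ) * θ : ℝ) : ℂ) * Complex.I := by
      push_cast; ring
    rw [hF]
    simp only [norm_mul]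
    rw [this, Complex.norm_exp_ofReal_mul_I, mul_one, Complex.norm_real, Real.norm_eq_abs]
  have h := intervalIntegral.hasSum_integral_of_dominated_convergence
    (μ := MeasureTheory.volume) (a := -Real.pi) (b := Real.pi) (F := F)
    (f := fun θ => Complex.exp (l * (Complex.exp (θ * Complex.I) - 1) - b * θ * Complex.I))
    (fun n _ => |Real.exp (-l) * l ^ n / n.factorial|)
    (fun n => by
      refine Continuous.aestronglyMeasurable ?_
      rw [hF]; fun_prop)
    (fun n => Eventually.of_forall fun θ _ => (hFnorm n θ).le)
    (Eventually.of_forall fun θ _ => hS)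
    intervalIntegrable_const
    (Eventually.of_forall fun θ _ => by
      have h := (NormedSpace.expSeries_div_hasSum_exp (𝔸 := ℂ)
        ((l : ℂ) * Complex.exp (θ * Complex.I))).mul_left (Complex.exp (-l - b * θ * Complex.I))
      rw [← Complex.exp_eq_exp_ℂ, ← Complex.exp_add] at h
      have e : -(l : ℂ) - b * θ * Complex.I + l * Complex.exp (θ * Complex.I)
        = l * (Complex.exp (θ * Complex.I) - 1) - b * θ * Complex.I := by ring
      rw [e] at h
      refine h.congr_fun fun n => ?_
      rw [hF]
      simp only
      rw [mul_pow, ← Complex.exp_nat_mul]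
      push_cast
      rw [sub_eq_add_neg (-(l : ℂ)), Complex.exp_add]
      have e2 : ((n : ℂ) - b) * θ * Complex.I = -(b * θ * Complex.I) + n * (θ * Complex.I) := by ring
      rw [e2, Complex.exp_add]
      ring)
  have hval : ∀ n : ℕ, ∫ θ in (-Real.pi)..Real.pi, F n θ
      = if (n : ℤ) = b then (2 * Real.pi * poissonInt l b : ℂ) else 0 := fun n => by
    rw [hF]
    simp only
    rw [intervalIntegral.integral_const_mul, integral_exp_int_mul_I]
    split_ifs with h1 h2 h2
    · rw [← h2, poissonInt, if_pos (by positivity)]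
      simp; ring
    · omega
    · omega
    · simp
  simp_rw [hval] at h
  refine h.unique ?_
  by_cases hb : 0 ≤ b
  · lift b to ℕ using hb
    exact (hasSum_ite_eq b (2 * Real.pi * poissonInt l b : ℂ)).congr_fun fun n =>
      if_congr Nat.cast_inj rfl rfl
  · have : (fun n : ℕ => if (n : ℤ) = b then (2 * Real.pi * poissonInt l b : ℂ) else 0) = fun _ => 0 := by
      funext n
      rw [if_neg (by omega)]
    rw [this, poissonInt, if_neg hb]
    simp

/-- The characteristic function of the centred and rescaled Poisson distribution. -/
noncomputable def poissonCharFun (l t : ℝ) : ℂ :=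
  Complex.exp (l * (Complex.exp ((t / √l : ℝ) * Complex.I) - 1) - t * √l * Complex.I)

/-- Uses `cos x ≤ 1 - 2x²/π²` for `|x| ≤ π`; the bound does not depend on `l`, so it serves as the
majorant for dominated convergence. -/
theorem norm_poissonCharFun_le {l t : ℝ} (hl : 0 < l) (ht : |t| ≤ Real.pi * √l) :
    ‖poissonCharFun l t‖ ≤ Real.exp (-(2 / Real.pi ^ 2) * t ^ 2) := by
  have hsq := Real.sqrt_pos.2 hl
  rw [poissonCharFun, Complex.norm_exp]
  refine Real.exp_le_exp.2 ?_
  have h1 : |t / √l| ≤ Real.pi := by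
    rw [abs_div, abs_of_pos hsq, div_le_iff₀ hsq]; exact ht
  have h2 := Real.cos_le_one_sub_mul_cos_sq h1
  have h3 : (l * (Complex.exp ((t / √l : ℝ) * Complex.I) - 1) - t * √l * Complex.I : ℂ).re
      = l * (Real.cos (t / √l) - 1) := by
    rw [Complex.sub_re, Complex.re_ofReal_mul, Complex.sub_re, Complex.exp_ofReal_mul_I_re,
      Complex.one_re]
    simp
  rw [h3]
  have h4 : l * (t / √l) ^ 2 = t ^ 2 := by
    rw [div_pow, Real.sq_sqrt hl.le]; field_simp
  calc l * (Real.cos (t / √l) - 1) ≤ l * (-(2 / Real.pi ^ 2) * (t / √l) ^ 2) :=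
        mul_le_mul_of_nonneg_left (by linarith) hl.le
    _ = -(2 / Real.pi ^ 2) * t ^ 2 := by rw [mul_left_comm, h4]

theorem tendsto_poissonCharFun (t : ℝ) :
    Tendsto (fun l => poissonCharFun l t) atTop (nhds (Complex.exp (-(1 / 2) * t ^ 2))) := by
  have key : Tendsto (fun l : ℝ => (l * (Complex.exp ((t / √l : ℝ) * Complex.I) - 1)
      - t * √l * Complex.I : ℂ)) atTop (nhds (-(1 / 2) * t ^ 2)) := by
    have hs : Tendsto (fun l : ℝ => √l) atTop atTop := Real.tendsto_sqrt_atTop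
    have h0 : Tendsto (fun l : ℝ => |t| / √l) atTop (nhds 0) := tendsto_const_nhds.div_atTop hs
    rw [tendsto_iff_norm_sub_tendsto_zero]
    have h1 : Tendsto (fun l : ℝ => |t| ^ 3 / √l) atTop (nhds 0) := tendsto_const_nhds.div_atTop hs
    refine squeeze_zero' (Eventually.of_forall fun _ => norm_nonneg _) ?_ h1
    filter_upwards [h0.eventually (ge_mem_nhds one_pos), eventually_gt_atTop 0] with l hl hl0
    have hsq := Real.sqrt_pos.2 hl0
    set z : ℂ := (t / √l : ℝ) * Complex.I with hz
    have hzn : ‖z‖ = |t| / √l := by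
      rw [hz, norm_mul, Complex.norm_I, mul_one, Complex.norm_real, Real.norm_eq_abs, abs_div,
        abs_of_pos hsq]
    -- After multiplication by `l`, the linear Taylor term cancels the centring, the quadratic one
    -- gives `-t²/2`, and the cubic remainder is `O(l^(-1/2))`.
    have hb := Complex.exp_bound (x := z) (by rw [hzn]; exact hl) (n := 3) (by norm_num)
    have hsc : ((√l : ℝ) : ℂ) ≠ 0 := by exact_mod_cast hsq.ne'
    have hll : (l : ℂ) = (√l : ℝ) ^ 2 := by
      rw [← Complex.ofReal_pow, Real.sq_sqrt hl0.le]
    have heq : (l * (Complex.exp z - 1) - t * √l * Complex.I : ℂ) - -(1 / 2) * t ^ 2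
        = l * (Complex.exp z - ∑ m ∈ Finset.range 3, z ^ m / m.factorial) := by
      have e1 : (l : ℂ) * z = t * √l * Complex.I := by
        rw [hz, hll]; push_cast; field_simp
      have e2 : (l : ℂ) * z ^ 2 = - t ^ 2 := by
        rw [hz, hll, mul_pow, Complex.I_sq]; push_cast; field_simp
      simp only [Finset.sum_range_succ, Finset.sum_range_zero, Nat.factorial]
      push_cast
      linear_combination e1 + e2 / 2
    rw [heq, norm_mul, Complex.norm_real, Real.norm_eq_abs, abs_of_pos hl0]
    calc _ ≤ l * (‖z‖ ^ 3 * 1) := by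
          gcongr
          refine hb.trans ?_
          gcongr
          norm_num [Nat.factorial]
      _ = |t| ^ 3 / √l := by
          rw [hzn, mul_one, div_pow]
          have : l = √l ^ 2 := (Real.sq_sqrt hl0.le).symm
          rw [this, Real.sqrt_sq hsq.le]
          field_simp
  exact (Complex.continuous_exp.tendsto _).comp key

/-- The difference between the characteristic functions of the rescaled Poisson distribution and of
the standard Gaussian. -/
noncomputable def poissonCharFunError (l t : ℝ) : ℂ :=
  (Set.Ioc (-(Real.pi * √l)) (Real.pi * √l)).indicator (poissonCharFun l) t
    - Complex.exp (-(1 / 2) * t ^ 2)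

theorem integrable_cexp_neg_half_sq :
    MeasureTheory.Integrable fun t : ℝ => Complex.exp (-(1 / 2) * t ^ 2) := by
  simpa using integrable_cexp_neg_mul_sq (b := 1 / 2) (by norm_num)

theorem continuous_poissonCharFun (l : ℝ) : Continuous (poissonCharFun l) := by
  unfold poissonCharFun; fun_prop

theorem integrable_indicator_poissonCharFun (l : ℝ) :
    MeasureTheory.Integrable
      ((Set.Ioc (-(Real.pi * √l)) (Real.pi * √l)).indicator (poissonCharFun l)) :=
  (((continuous_poissonCharFun l).integrableOn_Icc).mono_set Set.Ioc_subset_Icc_self).integrable_indicator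
    measurableSet_Ioc

theorem tendsto_integral_norm_poissonCharFunError :
    Tendsto (fun l => ∫ t, ‖poissonCharFunError l t‖) atTop (nhds 0) := by
  have hint : MeasureTheory.Integrable fun t : ℝ =>
      Real.exp (-(2 / Real.pi ^ 2) * t ^ 2) + ‖Complex.exp (-(1 / 2) * t ^ 2)‖ :=
    (integrable_exp_neg_mul_sq (by positivity)).add integrable_cexp_neg_half_sq.norm
  have h := MeasureTheory.tendsto_integral_filter_of_dominated_convergence
    (μ := MeasureTheory.volume) (l := atTop) (F := fun l t => ‖poissonCharFunError l t‖)
    (f := fun _ => 0) _ ?_ ?_ hint ?_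
  · simpa using h
  · exact Eventually.of_forall fun l => ((integrable_indicator_poissonCharFun l).sub
      integrable_cexp_neg_half_sq).norm.aestronglyMeasurable
  · filter_upwards [eventually_gt_atTop 0] with l hl
    refine Eventually.of_forall fun t => ?_
    rw [norm_norm, poissonCharFunError]
    refine (norm_sub_le _ _).trans (add_le_add_left ?_ _)
    rw [Set.indicator_apply]
    split_ifs with ht
    · exact norm_poissonCharFun_le hl (abs_le.2 ⟨ht.1.le, ht.2⟩)
    · rw [norm_zero]; positivity
  · refine Eventually.of_forall fun t => ?_
    have h1 : Tendsto (fun l => poissonCharFunError l t) atTop (nhds 0) := by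
      rw [← sub_self (Complex.exp (-(1 / 2) * t ^ 2))]
      refine Tendsto.sub_const ?_ _
      refine (tendsto_poissonCharFun t).congr' ?_
      have hs : Tendsto (fun l : ℝ => Real.pi * √l) atTop atTop :=
        Real.tendsto_sqrt_atTop.const_mul_atTop Real.pi_pos
      filter_upwards [hs.eventually_gt_atTop |t|] with l hl
      rw [Set.indicator_of_mem]
      exact ⟨(abs_lt.1 hl).1, (abs_lt.1 hl).2.le⟩
    simpa using h1.norm

/-- Fourier inversion of both terms after the substitution `θ = t / √l`. The index `b` appears only
in the unimodular factor `φ`, so the bound is uniform in `b`. -/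
theorem abs_sqrt_mul_poissonInt_sub_le {l : ℝ} (hl : 0 < l) (b : ℤ) :
    |√l * poissonInt l b - gaussianProfile (√(2 * Real.pi))⁻¹ 1 l (b - l)|
      ≤ (2 * Real.pi)⁻¹ * ∫ t, ‖poissonCharFunError l t‖ := by
  have hsq := Real.sqrt_pos.2 hl
  have hsc : ((√l : ℝ) : ℂ) ≠ 0 := by exact_mod_cast hsq.ne'
  have hll : (l : ℂ) = (√l : ℝ) ^ 2 := by
    rw [← Complex.ofReal_pow, Real.sq_sqrt hl.le]
  set x : ℝ := (b - l) / √l with hx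
  set φ : ℝ → ℂ := fun t => Complex.exp (Complex.I * ((-x : ℝ) : ℂ) * t) with hφ
  have hφn : ∀ t, ‖φ t‖ = 1 := fun t => by
    have : Complex.I * ((-x : ℝ) : ℂ) * t = ((-x * t : ℝ) : ℂ) * Complex.I := by push_cast; ring
    rw [hφ]; simp only; rw [this, Complex.norm_exp_ofReal_mul_I]
  have hφc : Continuous φ := by rw [hφ]; fun_prop
  have hmulint : ∀ {f : ℝ → ℂ}, MeasureTheory.Integrable f →
      MeasureTheory.Integrable fun t => φ t * f t := fun {f} hf =>
    hf.bdd_mul (c := 1) hφc.aestronglyMeasurable (Eventually.of_forall fun t => (hφn t).le)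
  have h1 : ∫ t, φ t * (Set.Ioc (-(Real.pi * √l)) (Real.pi * √l)).indicator (poissonCharFun l) t
      = √l * (2 * Real.pi * poissonInt l b) := by
    rw [← integral_poisson_charFun]
    have e1 : (fun t => φ t *
        (Set.Ioc (-(Real.pi * √l)) (Real.pi * √l)).indicator (poissonCharFun l) t)
        = (Set.Ioc (-(Real.pi * √l)) (Real.pi * √l)).indicator fun t => φ t * poissonCharFun l t := by
      funext t
      rw [Set.indicator_apply, Set.indicator_apply]
      split_ifs <;> simp
    rw [e1, MeasureTheory.integral_indicator measurableSet_Ioc,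
      ← intervalIntegral.integral_of_le (by nlinarith [Real.pi_pos])]
    have e2 := intervalIntegral.integral_comp_div (a := -(Real.pi * √l)) (b := Real.pi * √l)
      (fun θ : ℝ => Complex.exp (l * (Complex.exp (θ * Complex.I) - 1) - b * θ * Complex.I)) hsq.ne'
    rw [neg_div, mul_div_cancel_right₀ _ hsq.ne', Complex.real_smul] at e2
    rw [← e2]
    refine intervalIntegral.integral_congr fun t _ => ?_
    simp only [hφ, poissonCharFun]
    rw [← Complex.exp_add]
    congr 1
    rw [hx]
    push_cast
    field_simp
    rw [hll]
    ring
  have h2 : ∫ t : ℝ, φ t * Complex.exp (-(1 / 2) * t ^ 2)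
      = 2 * Real.pi * gaussianProfile (√(2 * Real.pi))⁻¹ 1 l (b - l) := by
    have h := fourierIntegral_gaussian (b := 1 / 2) (by norm_num) ((-x : ℝ) : ℂ)
    rw [hφ]
    simp only
    refine h.trans ?_
    have e1 : ((Real.pi : ℂ) / (1 / 2)) ^ (1 / 2 : ℂ) = ((√(2 * Real.pi) : ℝ) : ℂ) := by
      rw [Real.sqrt_eq_rpow, Complex.ofReal_cpow (by positivity)]
      push_cast
      congr 1
      ring
    have e2 : (-((-x : ℝ) : ℂ) ^ 2 / (4 * (1 / 2)) : ℂ) = ((-(b - l) ^ 2 / (2 * 1 * l) : ℝ) : ℂ) := by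
      rw [hx]
      push_cast
      rw [hll]
      field_simp
      ring
    rw [e1, e2, gaussianProfile, ← Complex.ofReal_exp]
    have e3 : (2 * Real.pi) = √(2 * Real.pi) ^ 2 := (Real.sq_sqrt (by positivity)).symm
    have e4 : √(2 * Real.pi) ≠ 0 := by positivity
    norm_cast
    nth_rewrite 2 [e3]
    field_simp
  have h3 : ∫ t, φ t * poissonCharFunError l t
      = ((2 * Real.pi * (√l * poissonInt l b
        - gaussianProfile (√(2 * Real.pi))⁻¹ 1 l (b - l)) : ℝ) : ℂ) := by
    simp only [poissonCharFunError, mul_sub]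
    rw [MeasureTheory.integral_sub (hmulint (integrable_indicator_poissonCharFun l))
      (hmulint integrable_cexp_neg_half_sq), h1, h2]
    push_cast
    ring
  have h4 : ‖∫ t, φ t * poissonCharFunError l t‖ ≤ ∫ t, ‖poissonCharFunError l t‖ := by
    refine (MeasureTheory.norm_integral_le_integral_norm _).trans_eq ?_
    simp_rw [norm_mul, hφn, one_mul]
  rw [h3, Complex.norm_real, Real.norm_eq_abs, abs_mul, abs_of_pos (by positivity)] at h4
  rwa [← div_eq_inv_mul, le_div_iff₀' (by positivity)]

/-- The local limit theorem for the Poisson distribution. -/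
theorem isLocallyGaussian_poissonInt :
    IsLocallyGaussian poissonInt (√(2 * Real.pi))⁻¹ 1 1 := by
  refine ⟨⟨1, ?_⟩, fun ε hε => ?_⟩
  · filter_upwards [eventually_ge_atTop 0] with l hl
    exact ⟨poissonInt_nonneg hl, (hasSum_poissonInt l).summable, (hasSum_poissonInt l).tsum_eq.le⟩
  · have h := tendsto_integral_norm_poissonCharFunError.const_mul (2 * Real.pi)⁻¹
    rw [mul_zero] at h
    filter_upwards [h.eventually (ge_mem_nhds hε), eventually_gt_atTop 0] with l hl hl0 b
    rw [one_mul]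
    exact (abs_sqrt_mul_poissonInt_sub_le hl0 b).trans hl

/-! ### Powers of power series as iterated convolutions. -/

/-- Extension by zero to `ℤ` of the coefficients of a power series. -/
noncomputable def intCoeff (f : PowerSeries ℝ) (b : ℤ) : ℝ :=
  if 0 ≤ b then PowerSeries.coeff b.toNat f else 0

theorem intCoeff_natCast (f : PowerSeries ℝ) (n : ℕ) : intCoeff f n = PowerSeries.coeff n f := by
  simp [intCoeff]

theorem intConv_intCoeff (f g : PowerSeries ℝ) :
    intConv (intCoeff f) (intCoeff g) = intCoeff (f * g) := by
  funext n
  rw [intConv]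
  by_cases hn : 0 ≤ n
  · lift n to ℕ using hn
    rw [intCoeff_natCast, PowerSeries.coeff_mul, Finset.Nat.sum_antidiagonal_eq_sum_range_succ_mk,
      tsum_eq_sum (s := (Finset.range (n + 1)).map ⟨((↑) : ℕ → ℤ), Nat.cast_injective⟩)]
    · rw [Finset.sum_map]
      refine Finset.sum_congr rfl fun j hj => ?_
      have hj' : j ≤ n := Nat.lt_succ_iff.1 (Finset.mem_range.1 hj)
      simp only [Function.Embedding.coeFn_mk]
      rw [← Nat.cast_sub hj', intCoeff_natCast, intCoeff_natCast]
    · intro j hj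
      by_cases h0 : 0 ≤ j
      · lift j to ℕ using h0
        have hj' : ¬ j ≤ n := fun h => hj <| by simpa using Nat.lt_succ_iff.2 h
        have : intCoeff g (n - j) = 0 := by rw [intCoeff, if_neg (by omega)]
        rw [this, mul_zero]
      · rw [intCoeff, if_neg h0, zero_mul]
  · have : ∀ j, intCoeff f j * intCoeff g (n - j) = 0 := fun j => by
      by_cases h0 : 0 ≤ j
      · have : intCoeff g (n - j) = 0 := by rw [intCoeff, if_neg (by omega)]
        rw [this, mul_zero]
      · rw [intCoeff, if_neg h0, zero_mul]
    simp_rw [this]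
    rw [tsum_zero, intCoeff, if_neg hn]

theorem IsLocallyGaussian.intCoeff_pow {F : ℝ → PowerSeries ℝ} {A v : ℝ} (hv : 0 < v)
    (h : IsLocallyGaussian (fun l => intCoeff (F l)) A v 1) (k : ℕ) :
    IsLocallyGaussian (fun l => intCoeff (F l ^ (k + 1)))
      (A ^ (k + 1) * √(2 * Real.pi * v) ^ k / √(k + 1)) ((k + 1) * v) (k + 1) := by
  induction k with
  | zero => simpa using h
  | succ k ih =>
    have hc := ih.conv h (by positivity) hv
    have e1 : (fun l => intConv (intCoeff (F l ^ (k + 1))) (intCoeff (F l)))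
        = fun l => intCoeff (F l ^ (k + 1 + 1)) := by
      funext l
      rw [intConv_intCoeff, pow_succ _ (k + 1)]
    have e2 : (k + 1) * v + v = (((k + 1 : ℕ) : ℝ) + 1) * v := by push_cast; ring
    have e3 : (k + 1 : ℝ) + 1 = ((k + 1 : ℕ) : ℝ) + 1 := by push_cast; ring
    -- The new Gaussian factor has variance `v * (k + 1) / (k + 2)`, so the square roots telescope.
    have e4 : A ^ (k + 1) * √(2 * Real.pi * v) ^ k / √(k + 1) * A *
        √(2 * Real.pi * ((k + 1) * v * v / ((k + 1) * v + v)))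
        = A ^ (k + 1 + 1) * √(2 * Real.pi * v) ^ (k + 1) / √(((k + 1 : ℕ) : ℝ) + 1) := by
      have e5 : 2 * Real.pi * ((k + 1) * v * v / ((k + 1) * v + v))
          = (2 * Real.pi * v) * (k + 1) / ((k + 1 : ℕ) + 1) := by
        push_cast
        have : (k + 1 : ℝ) * v + v = (k + 1 + 1) * v := by ring
        rw [this]
        field_simp
      rw [e5, Real.sqrt_div (by positivity), Real.sqrt_mul (by positivity) (k + 1 : ℝ)]
      have h1 : √((k : ℝ) + 1) ≠ 0 := by positivity
      have h2 : √(((k + 1 : ℕ) : ℝ) + 1) ≠ 0 := by positivity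
      generalize √(2 * Real.pi * v) = S
      field_simp
      ring
    rw [e1, e4, e2, e3] at hc
    exact hc

/-- The power series with coefficients `(√l * (exp (-l) * l ^ b / b!)) ^ p / √l`. -/
noncomputable def poissonPowSeries (p : ℕ) (l : ℝ) : PowerSeries ℝ :=
  PowerSeries.mk fun b => (√l * (Real.exp (-l) * l ^ b / b.factorial)) ^ p / √l

theorem intCoeff_poissonPowSeries {p : ℕ} (hp : p ≠ 0) (l : ℝ) (b : ℤ) :
    intCoeff (poissonPowSeries p l) b = (√l * poissonInt l b) ^ p / √l := by
  rw [intCoeff, poissonInt]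
  split_ifs
  · rw [poissonPowSeries, PowerSeries.coeff_mk]
  · simp [hp]

theorem coeff_poissonPowSeries_pow (p m n : ℕ) (l : ℝ) :
    PowerSeries.coeff n (poissonPowSeries p l ^ m)
      = ((√l * Real.exp (-l)) ^ p / √l) ^ m * l ^ (p * n) *
        PowerSeries.coeff n ((PowerSeries.mk fun b => ((b.factorial : ℝ)⁻¹) ^ p) ^ m) := by
  have h : poissonPowSeries p l = PowerSeries.C ((√l * Real.exp (-l)) ^ p / √l) *
      PowerSeries.rescale (l ^ p) (PowerSeries.mk fun b => ((b.factorial : ℝ)⁻¹) ^ p) := by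
    ext b
    rw [PowerSeries.coeff_C_mul, PowerSeries.coeff_rescale, poissonPowSeries, PowerSeries.coeff_mk,
      PowerSeries.coeff_mk]
    ring
  rw [h, mul_pow, ← map_pow, ← map_pow, PowerSeries.coeff_C_mul, PowerSeries.coeff_rescale, pow_mul,
    mul_assoc]

/-! ### Asymptotics of the probability. -/

/-- Stirling's formula, as the local limit theorem at the mean of the Poisson distribution. -/
theorem tendsto_sqrt_mul_poissonInt_self :
    Tendsto (fun N : ℕ => √(N : ℝ) * poissonInt N N) atTop (nhds (√(2 * Real.pi))⁻¹) := by
  rw [Metric.tendsto_atTop']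
  intro ε hε
  have h := tendsto_natCast_atTop_atTop.eventually
    (isLocallyGaussian_poissonInt.approx (ε / 2) (by positivity))
  obtain ⟨N₀, h⟩ := eventually_atTop.1 h
  refine ⟨N₀, fun N hN => ?_⟩
  have := h N hN.le N
  rw [one_mul, Int.cast_natCast, sub_self, gaussianProfile] at this
  rw [Real.dist_eq]
  refine lt_of_le_of_lt ?_ (half_lt_self hε)
  simpa using this

theorem tendsto_sqrt_mul_coeff_poissonPowSeries {p m : ℕ} (hp : 0 < p) (hm : 0 < m) :
    Tendsto (fun n : ℕ => √((n : ℝ) / m) *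
        PowerSeries.coeff n (poissonPowSeries p ((n : ℝ) / m) ^ m)) atTop
      (nhds ((√(2 * Real.pi))⁻¹ ^ (p * m) * √(2 * Real.pi / p) ^ (m - 1) / √m)) := by
  obtain ⟨k, rfl⟩ : ∃ k, m = k + 1 := ⟨m - 1, (Nat.succ_pred_eq_of_pos hm).symm⟩
  have hg : IsLocallyGaussian (fun l => intCoeff (poissonPowSeries p l))
      ((√(2 * Real.pi))⁻¹ ^ p) (1 / p) 1 := by
    have h := isLocallyGaussian_poissonInt.pow one_pos hp.ne'
    have e : (fun (l : ℝ) b => (√l * poissonInt l b) ^ p / √l)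
        = fun l => intCoeff (poissonPowSeries p l) := by
      funext l b
      rw [intCoeff_poissonPowSeries hp.ne']
    rwa [e] at h
  have hk := hg.intCoeff_pow (by positivity) k
  rw [Metric.tendsto_atTop']
  intro ε hε
  have hl : Tendsto (fun n : ℕ => (n : ℝ) / ((k + 1 : ℕ) : ℝ)) atTop atTop :=
    tendsto_natCast_atTop_atTop.atTop_div_const (by positivity)
  obtain ⟨n₀, h⟩ := eventually_atTop.1 (hl.eventually (hk.approx (ε / 2) (by positivity)))
  refine ⟨n₀, fun n hn => ?_⟩
  have := h n hn.le n
  -- The choice `l = n / m` puts `n` exactly at the centre, so the Gaussian exponential equals 1.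
  have e0 : ((n : ℤ) : ℝ) - (k + 1) * (n / ((k + 1 : ℕ) : ℝ)) = 0 := by
    push_cast; field_simp; ring
  rw [e0, intCoeff_natCast, gaussianProfile, ← pow_mul, mul_one_div] at this
  rw [Real.dist_eq]
  refine lt_of_le_of_lt ?_ (half_lt_self hε)
  simpa using this

theorem tendsto_partialButsonProb_mul {p k m : ℕ} (hp : p.Prime) (hm : m = p ^ k) :
    Tendsto (fun n : ℕ => partialButsonProb (p * m) 2 (p * n) * √((n : ℝ) / m) ^ ((p - 1) * m))
      atTop (nhds (√((p : ℝ) ^ 2 / p ^ m / (2 * Real.pi) ^ ((p - 1) * m)))) := by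
  have hp0 : 0 < p := hp.pos
  have hm0 : 0 < m := hm ▸ pow_pos hp.pos _
  have hmul : Tendsto (fun n : ℕ => p * n) atTop atTop := tendsto_id.const_mul_atTop' hp0
  have h1 := tendsto_sqrt_mul_poissonInt_self.comp hmul
  have h2 := tendsto_sqrt_mul_coeff_poissonPowSeries hp0 hm0
  -- Dividing by the Poisson probability at `N = pn` produces `(pn)!` and cancels `exp (-pn)` and `l
  -- ^ (pn)`; the factor `√(p * m)` comes from `√(pn) = √(pm) * √l`.
  have h3 := (h2.div h1 (by positivity)).const_mul √((p : ℝ) * m)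
  have hconst : √((p : ℝ) * m) * ((√(2 * Real.pi))⁻¹ ^ (p * m) * √(2 * Real.pi / p) ^ (m - 1) / √m
      / (√(2 * Real.pi))⁻¹) = √((p : ℝ) ^ 2 / p ^ m / (2 * Real.pi) ^ ((p - 1) * m)) := by
    obtain ⟨j, rfl⟩ : ∃ j, m = j + 1 := ⟨m - 1, (Nat.succ_pred_eq_of_pos hm0).symm⟩
    obtain ⟨r, rfl⟩ : ∃ r, p = r + 1 := ⟨p - 1, (Nat.succ_pred_eq_of_pos hp0).symm⟩
    symm
    rw [Real.sqrt_eq_iff_eq_sq (by positivity) (by positivity), Nat.add_sub_cancel,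
      Nat.add_sub_cancel]
    have hx : 0 < 2 * Real.pi := by positivity
    have hy : (0 : ℝ) < (r + 1 : ℕ) := by positivity
    have hz : (0 : ℝ) < (j + 1 : ℕ) := by positivity
    generalize 2 * Real.pi = x at hx ⊢
    generalize ((r + 1 : ℕ) : ℝ) = y at hy ⊢
    generalize ((j + 1 : ℕ) : ℝ) = z at hz ⊢
    have e : (√(y * z) * ((√x)⁻¹ ^ ((r + 1) * (j + 1)) * √(x / y) ^ j / √z / (√x)⁻¹)) ^ 2
        = √(y * z) ^ 2 * ((√x ^ 2)⁻¹ ^ ((r + 1) * (j + 1)) * (√(x / y) ^ 2) ^ j / √z ^ 2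
          / (√x ^ 2)⁻¹) := by
      simp only [mul_pow, div_pow, inv_pow, ← pow_mul, mul_comm 2]
    have e' : x ^ ((r + 1) * (j + 1)) = x ^ (r * (j + 1)) * (x ^ j * x) := by ring
    rw [e, Real.sq_sqrt (by positivity), Real.sq_sqrt hx.le, Real.sq_sqrt (by positivity),
      Real.sq_sqrt hz.le, inv_pow, e', div_pow]
    field_simp
    ring
  rw [hconst] at h3
  refine h3.congr' ?_
  filter_upwards [eventually_gt_atTop 0] with n hn
  have hn' : (0 : ℝ) < n := Nat.cast_pos.2 hn
  have hm' : (0 : ℝ) < m := Nat.cast_pos.2 hm0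
  have hp' : (0 : ℝ) < p := Nat.cast_pos.2 hp0
  rw [partialButsonProb_two_prime_pow hp hm, Pi.div_apply, coeff_poissonPowSeries_pow]
  simp only [Function.comp_apply]
  rw [poissonInt, if_pos (by positivity), Int.toNat_natCast]
  set l : ℝ := (n : ℝ) / m with hl
  have hl0 : 0 < l := by positivity
  have hnl : (n : ℝ) = m * l := by rw [hl]; field_simp
  have hsl : 0 < √l := Real.sqrt_pos.2 hl0
  have e1 : √(((p * n : ℕ) : ℝ)) = √((p : ℝ) * m) * √l := by
    rw [← Real.sqrt_mul (by positivity)]; congr 1; push_cast; rw [hnl]; ring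
  have e2 : ((p * n : ℕ) : ℝ) ^ (p * n) = ((p : ℝ) * m) ^ (p * n) * l ^ (p * n) := by
    rw [← mul_pow]; congr 1; push_cast; rw [hnl]; ring
  have e3 : ((√l * Real.exp (-l)) ^ p / √l) ^ m
      = √l ^ ((p - 1) * m) * Real.exp (-((p * n : ℕ) : ℝ)) := by
    obtain ⟨r, rfl⟩ : ∃ r, p = r + 1 := ⟨p - 1, (Nat.succ_pred_eq_of_pos hp0).symm⟩
    have : Real.exp (-(((r + 1) * n : ℕ) : ℝ)) = (Real.exp (-l)) ^ ((r + 1) * m) := by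
      rw [← Real.exp_nat_mul]; congr 1; push_cast; rw [hnl]; ring
    rw [this, mul_pow, pow_succ (√l), mul_right_comm, mul_div_cancel_right₀ _ hsl.ne', mul_pow,
      ← pow_mul, ← pow_mul, Nat.add_sub_cancel]
  rw [e1, e2, e3]
  have hs : 0 < √((p : ℝ) * m) := Real.sqrt_pos.2 (by positivity)
  have hf : (0 : ℝ) < (p * n).factorial := by positivity
  have hex := Real.exp_pos (-((p * n : ℕ) : ℝ))
  field_simp

/-- With `q = p * m` the exponents `q / p = m` and `q - q / p = (p - 1) * m` are integers, so the
powers of `n` cancel exactly and leave the limit of `tendsto_partialButsonProb_mul`. -/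
theorem sqrt_asymptotic_mul {p m : ℕ} (hp : 0 < p) (hm : 0 < m) {n : ℕ} (hn : 0 < n) :
    √((p : ℝ) ^ (2 - ((p * m : ℕ) : ℝ) / (p : ℝ)) *
        ((p * m : ℕ) : ℝ) ^ (((p * m : ℕ) : ℝ) - ((p * m : ℕ) : ℝ) / (p : ℝ)) /
          (2 * Real.pi * ((p * n : ℕ) : ℝ)) ^ (((p * m : ℕ) : ℝ) - ((p * m : ℕ) : ℝ) / (p : ℝ)))
      * √((n : ℝ) / m) ^ ((p - 1) * m)
      = √((p : ℝ) ^ 2 / p ^ m / (2 * Real.pi) ^ ((p - 1) * m)) := by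
  have hn' : (0 : ℝ) < n := Nat.cast_pos.2 hn
  have hm' : (0 : ℝ) < m := Nat.cast_pos.2 hm
  have hp' : (0 : ℝ) < p := Nat.cast_pos.2 hp
  have e1 : ((p * m : ℕ) : ℝ) / p = m := by push_cast; field_simp
  have e2 : ((p * m : ℕ) : ℝ) - m = (((p - 1) * m : ℕ) : ℝ) := by
    push_cast [Nat.cast_sub (Nat.one_le_iff_ne_zero.2 hp.ne')]; ring
  rw [e1, e2, Real.rpow_natCast, Real.rpow_natCast, Real.rpow_sub hp', Real.rpow_natCast,
    Real.rpow_two]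
  have e3 : √((n : ℝ) / m) ^ ((p - 1) * m) = √(((n : ℝ) / m) ^ ((p - 1) * m)) := by
    symm
    rw [Real.sqrt_eq_iff_eq_sq (by positivity) (by positivity), ← pow_mul, mul_comm _ 2,
      pow_mul (√_), Real.sq_sqrt (by positivity)]
  rw [e3, ← Real.sqrt_mul (by positivity)]
  congr 1
  push_cast
  have := Real.pi_pos
  simp only [mul_pow, div_pow]
  field_simp

theorem atTopMultiples_le (p : ℕ) : atTopMultiples p ≤ map (fun n => p * n) atTop := by
  intro s hs
  obtain ⟨n₀, hn₀⟩ := eventually_atTop.1 (mem_map.1 hs)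
  rw [atTopMultiples, mem_inf_principal]
  filter_upwards [eventually_ge_atTop (p * n₀), eventually_gt_atTop 0] with N hN hN0
  rintro ⟨n, rfl⟩
  have hp : 0 < p := Nat.pos_of_mul_pos_right hN0
  exact hn₀ n (Nat.le_of_mul_le_mul_left hN hp)

theorem isEquivalent_partialButsonProb {p k m : ℕ} (hp : p.Prime) (hm : m = p ^ k) :
    (fun N : ℕ => partialButsonProb (p * m) 2 N) ~[atTopMultiples p]
      (fun N : ℕ => √((p : ℝ) ^ (2 - ((p * m : ℕ) : ℝ) / (p : ℝ)) *
        ((p * m : ℕ) : ℝ) ^ (((p * m : ℕ) : ℝ) - ((p * m : ℕ) : ℝ) / (p : ℝ)) /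
          (2 * Real.pi * (N : ℝ)) ^ (((p * m : ℕ) : ℝ) - ((p * m : ℕ) : ℝ) / (p : ℝ)))) := by
  have hm0 : 0 < m := hm ▸ pow_pos hp.pos _
  refine IsLittleO.mono ?_ (atTopMultiples_le p)
  rw [isLittleO_map]
  have hp' : (0 : ℝ) < p := Nat.cast_pos.2 hp.pos
  have hL : √((p : ℝ) ^ 2 / p ^ m / (2 * Real.pi) ^ ((p - 1) * m)) ≠ 0 := by positivity
  have h := (tendsto_partialButsonProb_mul hp hm).div_const
    √((p : ℝ) ^ 2 / p ^ m / (2 * Real.pi) ^ ((p - 1) * m))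
  rw [div_self hL] at h
  refine isEquivalent_of_tendsto_one (h.congr' ?_)
  filter_upwards [eventually_gt_atTop 0] with n hn
  have hn' : (0 : ℝ) < n := Nat.cast_pos.2 hn
  have hm' : (0 : ℝ) < m := Nat.cast_pos.2 hm0
  rw [← sqrt_asymptotic_mul hp.pos hm0 hn, Pi.div_apply, mul_div_mul_right]
  positivity

theorem theorem2p5 (p k q : ℕ) (hp : p.Prime) (hk : 1 ≤ k) (hq : q = p ^ k) :
    ((fun N : ℕ => partialButsonProb q 2 N) ~[atTopMultiples p]
      (fun N : ℕ => Real.sqrt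
        ((p : ℝ) ^ (2 - (q : ℝ) / (p : ℝ)) * (q : ℝ) ^ ((q : ℝ) - (q : ℝ) / (p : ℝ)) /
          (2 * Real.pi * (N : ℝ)) ^ ((q : ℝ) - (q : ℝ) / (p : ℝ))))) ∧
    (q = p →
      (fun N : ℕ => partialButsonProb q 2 N) ~[atTopMultiples p]
        (fun N : ℕ => Real.sqrt ((p : ℝ) ^ p / (2 * Real.pi * (N : ℝ)) ^ (p - 1)))) ∧
    (p = 2 →
      (fun N : ℕ => partialButsonProb q 2 N) ~[atTopMultiples p]
        (fun N : ℕ => 2 * Real.sqrt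
          (((q : ℝ) / 2 / (2 * Real.pi * (N : ℝ))) ^ ((q : ℝ) / 2)))) := by
  obtain ⟨k, rfl⟩ : ∃ j, k = j + 1 := ⟨k - 1, (Nat.succ_pred_eq_of_pos hk).symm⟩
  rw [pow_succ'] at hq
  have hmain := isEquivalent_partialButsonProb (k := k) hp rfl
  rw [← hq] at hmain
  have hp' : (0 : ℝ) < p := Nat.cast_pos.2 hp.pos
  have hpi := Real.pi_pos
  refine ⟨hmain, fun hqp => ?_, fun hp2 => ?_⟩
  · refine hmain.congr_right (Eventually.of_forall fun N => ?_)
    have e1 : (p : ℝ) - 1 = ((p - 1 : ℕ) : ℝ) := by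
      push_cast [Nat.cast_sub (Nat.one_le_iff_ne_zero.2 hp.ne_zero)]; ring
    have e2 : (p : ℝ) ^ p = p * (p : ℝ) ^ (p - 1) := by
      rw [← pow_succ', Nat.sub_add_cancel hp.one_le]
    simp only
    rw [hqp, div_self hp'.ne', e1, Real.rpow_natCast, Real.rpow_natCast, e2]
    norm_num
  · refine hmain.congr_right (Eventually.of_forall fun N => ?_)
    subst hp2
    simp only
    have hq0 : (0 : ℝ) ≤ q := Nat.cast_nonneg q
    have e1 : (q : ℝ) - q / (2 : ℕ) = q / 2 := by push_cast; ring
    -- The prefactor 2 is the root of `p ^ 2 = 4`, because `2 ^ (2 - q/2) * q ^ (q/2) = 4 * (q/2) ^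
    -- (q/2)`.
    have e2 : ∀ x : ℝ, 2 * √x = √(4 * x) := fun x => by
      rw [Real.sqrt_mul (by norm_num), show (4 : ℝ) = 2 ^ 2 by norm_num, Real.sqrt_sq (by norm_num)]
    rw [e1, e2]
    congr 1
    rw [Real.div_rpow (by positivity) (by positivity), Real.div_rpow (by positivity) (by positivity)]
    push_cast
    rw [Real.rpow_sub (by norm_num), Real.rpow_two]
    norm_num
    ring
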